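/- \textbf{Diagrams and state sum.} Let $D$ be an oriented link diagram in the plane whose underlying 4-regular plane graph is connected and has at least one crossing. Its faces are the connected components of the complement of the graph. At each crossing $\chi$ let $F_0^\chi$ be the face at the angle between the two incoming ends, and $F_1^\chi,F_2^\chi,F_3^\chi$ the faces at the other three angles in counterclockwise order (the four faces need not be distinct). A state $\sigma$ assigns to every face a colour $0$ (white) or $1$ (black) so that no two faces sharing an edge are both black. Put $|\sigma_\chi|=8\sigma(F_0^\chi)+4\sigma(F_1^\chi)+2\sigma(F_2^\chi)+\sigma(F_3^\chi)$; in a state this lies in $\{0,1,2,4,5,8,10\}$. Let $R$ be a commutative ring with $16$ chosen elements $f_0,f_1$ and $x_i,X_i$ for $i\in\{0,1,2,4,5,8,10\}$. The monomial of $\sigma$ is the product of $X_{|\sigma_\chi|}$ over the positive crossings, $x_{|\sigma_\chi|}$ over the negative crossings, and $f_{\sigma(F)}$ over the faces $F$. The state sum $[D]\in R$ is the sum of the monomials of all states of $D$. \textbf{Moves.} \emph{Move 2a} (restricted form): in one diagram two strands, both going upwards, cross first at a positive crossing and then at a negative crossing, and these two crossings are the vertices of a bigonal face; the face above the upper crossing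 and the face below the lower crossing are distinct. In the other diagram the two crossings are removed, so that the strands run side by side; the rest is unchanged. \emph{Move 3a}: the third Reidemeister move on a triangular face with three distinct vertices whose edges are coherently oriented, running clockwise on one side of the move and counterclockwise on the other, two of its crossings being positive and one negative. Both diagrams of a move are assumed to be connected with at least one crossing. \textbf{Theorem.} Suppose that the 16 elements satisfy the following 25 equations. For move 2a: $$\begin{aligned} & f_0^3x_0X_0+f_0^2f_1X_2x_8=f_0, && f_0^2f_1x_0X_8+f_0f_1^2x_8X_{10}=0,\\ & f_0^3x_1X_1=f_0, && f_0^2f_1X_0x_2+f_0f_1^2X_2x_{10}=0,\\ & f_0f_1^2x_2X_8+f_1^3x_{10}X_{10}-f_1=0, && f_0^3x_4X_4=f_0,\\ & f_0^3x_5X_5=f_0. && \end{aligned}$$ For move 3a: $$\begin{aligned} & f_0x_0X_0^2+f_1x_1X_4^2=f_0x_0X_0^2+f_1x_1X_1^2, && f_0x_0X_0X_1+f_1x_1X_4X_5=f_0X_0X_2x_8,\\ & f_0X_0X_2x_8=f_0x_0X_0X_4+f_1x_1X_1X_5, && f_0X_0^2x_1+f_1X_4^2x_5=f_0x_0X_2X_8,\\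 & f_0X_0x_1X_1+f_1X_4x_5X_5=f_0X_2x_8X_{10}, && f_0X_0x_2X_8=f_0x_0X_0X_4+f_1x_1X_1X_5,\\ & f_0X_1x_2X_8=f_0X_2X_4x_8, && f_0X_2X_8x_{10}=f_0x_0X_4^2+f_1x_1X_5^2,\\ & f_0x_0X_0X_1+f_1x_4X_4X_5=f_0X_0x_2X_8, && f_0x_0X_1^2+f_1x_4X_5^2=f_0X_2X_8x_{10},\\ & f_0X_1X_2x_8=f_0x_2X_4X_8, && f_0X_0x_1X_1+f_1X_4x_5X_5=f_0x_2X_8X_{10},\\ & f_0x_1X_1^2+f_1x_5X_5^2=f_0x_{10}X_{10}^2, && f_0x_0X_2X_8=f_0X_0^2x_4+f_1X_1^2x_5,\\ & f_0X_2x_8X_{10}=f_0X_0x_4X_4+f_1X_1x_5X_5, && f_0x_1X_2X_8=f_0X_2x_4X_8,\\ & f_0x_2X_8X_{10}=f_0X_0x_4X_4+f_1X_1x_5X_5, && f_0x_{10}X_{10}^2=f_0x_4X_4^2+f_1x_5X_5^2. \end{aligned}$$ Then the state sum is invariant under moves 2a and 3a: if $D$ and $D'$ are related by one of these moves, then $[D]=[D']$.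 -/

import Mathlib

/-- The two sides of a crossing that is drawn with both of its strands going upwards. -/
inductive Side
  | left
  | right
  deriving DecidableEq

/-!
Picture of a crossing `v`, both strands oriented upwards. The four angles are numbered
counterclockwise, number `0` being the one between the two incoming ends:

          outgoing left    2    outgoing right
                        \     /
                     3     v     1
                        /     \
          incoming left    0    incoming right

The two strands join incoming left to outgoing right, and incoming right to outgoing left.
The connected 4-regular plane graph underlying a link diagram is encoded by its rotation system:
an edge is named by the outgoing end at which it starts, and `next` gives the incoming end at
which it arrives.
-/

/-- The combinatorial data of an oriented link diagram with set of crossings `V`: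
`next (v, s) = (u, t)` means that the edge leaving `v` through its outgoing end on side `s`
arrives at `u` through the incoming end on side `t`; `overIn v` is the side of the incoming end
of the over-strand at `v`. -/
structure OrientedCode (V : Type*) where
  next : V × Side ≃ V × Side
  overIn : V → Side

namespace OrientedCode

/-- The angle to the left of an outgoing end. -/
def outLeft : Side → Fin 4
  | Side.left => 3
  | Side.right => 2

/-- The angle to the right of an outgoing end. -/
def outRight : Side → Fin 4
  | Side.left => 2
  | Side.right => 1

/-- The angle to the left of an incoming end (looking in the direction of travel). -/
def inLeft : Side → Fin 4
  | Side.left => 3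
  | Side.right => 0

/-- The angle to the right of an incoming end (looking in the direction of travel). -/
def inRight : Side → Fin 4
  | Side.left => 0
  | Side.right => 1

variable {V : Type*} (D : OrientedCode V)

/-- Two angles of crossings are related when they are the two angles at the ends of an edge, on
the same side of that edge. -/
inductive AngleRel : V × Fin 4 → V × Fin 4 → Prop
  | onLeft (e : V × Side) :
      AngleRel (e.1, outLeft e.2) ((D.next e).1, inLeft (D.next e).2)
  | onRight (e : V × Side) :
      AngleRel (e.1, outRight e.2) ((D.next e).1, inRight (D.next e).2)

/-- The faces: classes of angles under the equivalence relation generated by `AngleRel`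
(going around the boundary of the face). -/
def Face : Type _ := Quot D.AngleRel

/-- The face containing the angle number `i` of the crossing `v`. -/
def face (v : V) (i : Fin 4) : D.Face := Quot.mk _ (v, i)

/-- The face to the left of an edge. -/
def leftFace (e : V × Side) : D.Face := D.face e.1 (outLeft e.2)

/-- The face to the right of an edge. -/
def rightFace (e : V × Side) : D.Face := D.face e.1 (outRight e.2)

instance [Finite V] : Finite D.Face := by
  unfold Face
  infer_instance

noncomputable instance [Finite V] : Fintype D.Face := Fintype.ofFinite _

/-- A crossing is positive when its over-strand goes from lower left to upper right. -/
def IsPositive (v : V) : Prop := D.overIn v = Side.left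

/-- A state: a map from the faces to `{0, 1}` such that two faces sharing an edge do not both
have image `1`. -/
def State : Type _ :=
  {σ : D.Face → Fin 2 // ∀ e : V × Side, ¬ (σ (D.leftFace e) = 1 ∧ σ (D.rightFace e) = 1)}

instance [Finite V] : Finite D.State := by
  unfold State
  infer_instance

noncomputable instance [Finite V] : Fintype D.State := Fintype.ofFinite _

/-- The value of the four bits at the crossing `v`, read as a binary number. -/
def bits (σ : D.State) (v : V) : ℕ :=
  8 * (σ.1 (D.face v 0)).val + 4 * (σ.1 (D.face v 1)).val
    + 2 * (σ.1 (D.face v 2)).val + (σ.1 (D.face v 3)).val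

end OrientedCode

/-- An adequate projection: a connected oriented link diagram in the plane with at least one
crossing. A connected code is the code of a plane diagram exactly when the Euler characteristic
`crossings - edges + faces` is `2`, where the number of edges is twice that of crossings. -/
structure LinkDiagram (V : Type*) extends OrientedCode V where
  nonempty : Nonempty V
  connected : ∀ u v : V,
    Relation.EqvGen (fun a b => ∃ s : Side, (next (a, s)).1 = b) u v
  planar : Nat.card toOrientedCode.Face = Nat.card V + 2

/-- Values in `R` of the 16 variables of the state sum. -/
structure Weights (R : Type*) where
  (f0 f1 : R)
  (x0 x1 x2 x4 x5 x8 x10 : R)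
  (X0 X1 X2 X4 X5 X8 X10 : R)

namespace Weights

variable {R : Type*} [CommRing R] (w : Weights R)

/-- The variable of a face of colour `0` (white) or `1` (black). -/
def faceVar (c : Fin 2) : R := if c = 0 then w.f0 else w.f1

/-- The variable `x_n` of a negative crossing (other values of `n` do not occur in states). -/
def negVar : ℕ → R
  | 0 => w.x0
  | 1 => w.x1
  | 2 => w.x2
  | 4 => w.x4
  | 5 => w.x5
  | 8 => w.x8
  | 10 => w.x10
  | _ => 0

/-- The variable `X_n` of a positive crossing (other values of `n` do not occur in states). -/
def posVar : ℕ → R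
  | 0 => w.X0
  | 1 => w.X1
  | 2 => w.X2
  | 4 => w.X4
  | 5 => w.X5
  | 8 => w.X8
  | 10 => w.X10
  | _ => 0

/-- The first 7 of the 25 equations. -/
def Equations2a : Prop :=
  w.f0 ^ 3 * w.x0 * w.X0 + w.f0 ^ 2 * w.f1 * w.X2 * w.x8 = w.f0 ∧
  w.f0 ^ 2 * w.f1 * w.x0 * w.X8 + w.f0 * w.f1 ^ 2 * w.x8 * w.X10 = 0 ∧
  w.f0 ^ 3 * w.x1 * w.X1 = w.f0 ∧
  w.f0 ^ 2 * w.f1 * w.X0 * w.x2 + w.f0 * w.f1 ^ 2 * w.X2 * w.x10 = 0 ∧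
  w.f0 * w.f1 ^ 2 * w.x2 * w.X8 + w.f1 ^ 3 * w.x10 * w.X10 - w.f1 = 0 ∧
  w.f0 ^ 3 * w.x4 * w.X4 = w.f0 ∧
  w.f0 ^ 3 * w.x5 * w.X5 = w.f0

/-- The last 18 of the 25 equations. -/
def Equations3a : Prop :=
  w.f0 * w.x0 * w.X0 ^ 2 + w.f1 * w.x1 * w.X4 ^ 2
    = w.f0 * w.x0 * w.X0 ^ 2 + w.f1 * w.x1 * w.X1 ^ 2 ∧
  w.f0 * w.x0 * w.X0 * w.X1 + w.f1 * w.x1 * w.X4 * w.X5 = w.f0 * w.X0 * w.X2 * w.x8 ∧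
  w.f0 * w.X0 * w.X2 * w.x8 = w.f0 * w.x0 * w.X0 * w.X4 + w.f1 * w.x1 * w.X1 * w.X5 ∧
  w.f0 * w.X0 ^ 2 * w.x1 + w.f1 * w.X4 ^ 2 * w.x5 = w.f0 * w.x0 * w.X2 * w.X8 ∧
  w.f0 * w.X0 * w.x1 * w.X1 + w.f1 * w.X4 * w.x5 * w.X5 = w.f0 * w.X2 * w.x8 * w.X10 ∧
  w.f0 * w.X0 * w.x2 * w.X8 = w.f0 * w.x0 * w.X0 * w.X4 + w.f1 * w.x1 * w.X1 * w.X5 ∧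
  w.f0 * w.X1 * w.x2 * w.X8 = w.f0 * w.X2 * w.X4 * w.x8 ∧
  w.f0 * w.X2 * w.X8 * w.x10 = w.f0 * w.x0 * w.X4 ^ 2 + w.f1 * w.x1 * w.X5 ^ 2 ∧
  w.f0 * w.x0 * w.X0 * w.X1 + w.f1 * w.x4 * w.X4 * w.X5 = w.f0 * w.X0 * w.x2 * w.X8 ∧
  w.f0 * w.x0 * w.X1 ^ 2 + w.f1 * w.x4 * w.X5 ^ 2 = w.f0 * w.X2 * w.X8 * w.x10 ∧
  w.f0 * w.X1 * w.X2 * w.x8 = w.f0 * w.x2 * w.X4 * w.X8 ∧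
  w.f0 * w.X0 * w.x1 * w.X1 + w.f1 * w.X4 * w.x5 * w.X5 = w.f0 * w.x2 * w.X8 * w.X10 ∧
  w.f0 * w.x1 * w.X1 ^ 2 + w.f1 * w.x5 * w.X5 ^ 2 = w.f0 * w.x10 * w.X10 ^ 2 ∧
  w.f0 * w.x0 * w.X2 * w.X8 = w.f0 * w.X0 ^ 2 * w.x4 + w.f1 * w.X1 ^ 2 * w.x5 ∧
  w.f0 * w.X2 * w.x8 * w.X10 = w.f0 * w.X0 * w.x4 * w.X4 + w.f1 * w.X1 * w.x5 * w.X5 ∧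
  w.f0 * w.x1 * w.X2 * w.X8 = w.f0 * w.X2 * w.x4 * w.X8 ∧
  w.f0 * w.x2 * w.X8 * w.X10 = w.f0 * w.X0 * w.x4 * w.X4 + w.f1 * w.X1 * w.x5 * w.X5 ∧
  w.f0 * w.x10 * w.X10 ^ 2 = w.f0 * w.x4 * w.X4 ^ 2 + w.f1 * w.x5 * w.X5 ^ 2

end Weights

namespace LinkDiagram

variable {V V' : Type*}

open Classical in
/-- The monomial of a state: the product of the variables at the crossings and at the faces. -/
noncomputable def monomial {R : Type*} [CommRing R] [Fintype V] (w : Weights R)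
    (D : LinkDiagram V) (σ : D.State) : R :=
  (∏ v : V, if D.IsPositive v then w.posVar (D.bits σ v) else w.negVar (D.bits σ v)) *
    ∏ F : D.Face, w.faceVar (σ.1 F)

/-- The state sum of a diagram. -/
noncomputable def stateSum {R : Type*} [CommRing R] [Fintype V] (w : Weights R)
    (D : LinkDiagram V) : R :=
  ∑ σ : D.State, D.monomial w σ

open Classical in
/-- The incoming end reached by an edge arriving at `f`, once the two crossings `a`, `b` of a
bigon, `a` below `b`, have been pulled apart: the strand that arrives at `a` on one side goes on
along the edge that leaves `b` on the same side. -/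
noncomputable def skipBigon (D : LinkDiagram V) (a b : V) (f : V × Side) : V × Side :=
  if f.1 = a then D.next (b, f.2) else f

/-- `D'` is obtained from `D` by the move 2a, in the restricted form. In `D` two strands going
upwards side by side cross at `a` (positive) and then again at `b` (negative), the two crossings
being the vertices of a bigonal face; the faces above `b` and below `a` are distinct. In `D'` the
two crossings are removed and the strands run side by side. -/
def IsMove2a (D : LinkDiagram V) (D' : LinkDiagram V') : Prop :=
  ∃ a b : V,
    D.IsPositive a ∧ ¬ D.IsPositive b ∧
    D.next (a, Side.left) = (b, Side.left) ∧ D.next (a, Side.right) = (b, Side.right) ∧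
    D.face b 2 ≠ D.face a 0 ∧
    ∃ ι : V' ≃ {v : V // v ≠ a ∧ v ≠ b},
      (∀ v, D'.overIn v = D.overIn (ι v)) ∧
      ∀ (v : V') (s : Side),
        (((ι (D'.next (v, s)).1 : V), (D'.next (v, s)).2) : V × Side)
          = D.skipBigon a b (D.next (ι v, s))

open Classical in
/-- Exchange of the outgoing ends under the move 3a (see `IsMove3a`). -/
noncomputable def swapOut (p q r : V) : Equiv.Perm (V × Side) :=
  Equiv.swap (p, Side.right) (q, Side.left) * Equiv.swap (q, Side.right) (r, Side.left) *
    Equiv.swap (r, Side.right) (p, Side.left)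

open Classical in
/-- Exchange of the incoming ends under the move 3a (see `IsMove3a`). -/
noncomputable def swapIn (p q r : V) : Equiv.Perm (V × Side) :=
  Equiv.swap (p, Side.left) (q, Side.right) * Equiv.swap (q, Side.left) (r, Side.right) *
    Equiv.swap (r, Side.left) (p, Side.right)

/-- `D'` is obtained from `D` by the move 3a. In `D` the distinct crossings `p`, `q`, `r` are the
vertices of a triangular face whose edges run clockwise, from `p` to `q` to `r` to `p`; the signs
of `p`, `q` are positive and that of `r` is negative. One strand is moved across the crossing of
the other two. In `D'` every crossing persists with its over- and under-strand, but each of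
the three strands meets its two crossings in the opposite order.

Consider the strand along the edge from `p` to `q`. In `D` it enters at `p` from the left, leaves
`p` on the right for `q`, which it enters from the right, and exits from `q` on the left. In `D'`
it enters at `q` from the right, leaves `q` on the left for `p`, which it enters from the left,
and exits from `p` on the right. So the places of the incoming ends `(p, left)`, `(q, right)` are
exchanged, and likewise those of the outgoing ends `(p, right)`, `(q, left)`; similarly for the
other two strands. In particular the triangle of `D'` has edges from `q` to `p` to `r` to `q`,
running counterclockwise. All edges outside stay as they are. -/
def IsMove3a (D : LinkDiagram V) (D' : LinkDiagram V') : Prop :=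
  ∃ p q r : V,
    p ≠ q ∧ q ≠ r ∧ p ≠ r ∧
    D.IsPositive p ∧ D.IsPositive q ∧ ¬ D.IsPositive r ∧
    D.next (p, Side.right) = (q, Side.right) ∧
    D.next (q, Side.right) = (r, Side.right) ∧
    D.next (r, Side.right) = (p, Side.right) ∧
    ∃ ε : V ≃ V',
      (∀ v, D'.overIn (ε v) = D.overIn v) ∧
      ∀ e : V × Side,
        D'.next (Prod.map ε id (swapOut p q r e)) = Prod.map ε id (swapIn p q r (D.next e))

end LinkDiagram

/-!
The variables attached to a crossing are zero on the colour patterns that do not occur in states,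
so the state sum is a sum over all colourings of the faces, and it can be computed by summing first
over the colour of a single face. Away from a move the faces of the two diagrams correspond to each
other; the map between them obtained by following the angles is onto, and Euler's formula makes it
bijective.

For the move 3a, summing over the colour of the triangle on both sides leaves one identity for each
colouring of the hexagon of faces around it, and all of these follow from the equations. For the
move 2a, the equations say that summing over the colour of the bigon gives zero unless the faces
above and below it have the same colour, and removes the two crossings if they do. What is left
is the state sum of the other diagram, in which these two faces are one.
-/

instance : Finite Side :=
  Finite.of_injective (· = Side.left) (by rintro (_ | _) (_ | _) <;> simp)

/-- The extension of `f` to two more points, where it takes the values `a` and `b`. -/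
def extendByTwo {α β : Type*} (a b : β) (f : α → β) : Option (Option α) → β :=
  fun x => x.elim a fun y => y.elim b f

lemma extendByTwo_bijective {α β : Type*} {a b : β} (hab : a ≠ b)
    (ι : α ≃ {x : β // x ≠ a ∧ x ≠ b}) :
    Function.Bijective (extendByTwo a b fun x => (ι x : β)) := by
  have ne_left (x : α) : a ≠ ι x := (ι x).2.1.symm
  have ne_right (x : α) : b ≠ ι x := (ι x).2.2.symm
  constructor
  · rintro (_ | _ | x) (_ | _ | y) <;>
      simp [extendByTwo, hab, hab.symm, ne_left, ne_right, (ne_left _).symm, (ne_right _).symm,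
        Subtype.coe_inj]
  · intro y
    by_cases ha : y = a
    · exact ⟨none, ha.symm⟩
    by_cases hb : y = b
    · exact ⟨some none, hb.symm⟩
    · exact ⟨some (some (ι.symm ⟨y, ha, hb⟩)), by simp [extendByTwo]⟩

lemma sum_option_arrow {α β M : Type*} [Fintype α] [DecidableEq α] [Fintype β]
    [AddCommMonoid M] (f : (Option α → β) → M) :
    ∑ σ, f σ = ∑ τ : α → β, ∑ b, f fun x => x.elim b τ := by
  rw [← (Equiv.piOptionEquivProd (β := fun _ => β)).symm.sum_comp, Fintype.sum_prod_type_right]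
  refine Finset.sum_congr rfl fun τ _ => Finset.sum_congr rfl fun b _ => congrArg f ?_
  funext x
  cases x <;> rfl

lemma prod_eq_mul_mul_mul_prod_compl {α M : Type*} [Fintype α] [DecidableEq α] [CommMonoid M]
    {p q r : α} (hpq : p ≠ q) (hqr : q ≠ r) (hpr : p ≠ r) (f : α → M) :
    ∏ x, f x = f p * f q * f r * ∏ x ∈ ({p, q, r} : Finset α)ᶜ, f x := by
  rw [← Finset.prod_mul_prod_compl {p, q, r}, Finset.prod_insert (by simp [hpq, hpr]),
    Finset.prod_pair hqr, ← mul_assoc (f p)]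

lemma comp_vec_four {α β : Type*} (f : α → β) (x₀ x₁ x₂ x₃ : α) :
    f ∘ ![x₀, x₁, x₂, x₃] = ![f x₀, f x₁, f x₂, f x₃] := by
  funext i
  fin_cases i <;> rfl

namespace OrientedCode

variable {V X : Type*}

/-- The labels on the two sides, left and right, of an outgoing end, when `c` labels the angles. -/
def outSides (c : V → Fin 4 → X) (e : V × Side) : X × X :=
  (c e.1 (outLeft e.2), c e.1 (outRight e.2))

/-- The labels on the two sides, left and right, of an incoming end, when `c` labels the angles. -/
def inSides (c : V → Fin 4 → X) (e : V × Side) : X × X :=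
  (c e.1 (inLeft e.2), c e.1 (inRight e.2))

variable (D : OrientedCode V)

/-- A labelling of the angles that is constant on every face, so that it amounts to a labelling of
the faces. -/
def ConstantOnFaces (c : V → Fin 4 → X) : Prop :=
  ∀ e, outSides c e = inSides c (D.next e)

lemma constantOnFaces_face : D.ConstantOnFaces D.face := fun e =>
  Prod.ext (Quot.sound (AngleRel.onLeft e)) (Quot.sound (AngleRel.onRight e))

variable {D}

/-- The labelling of the faces given by a labelling of the angles that is constant on faces. -/
def ConstantOnFaces.lift {c : V → Fin 4 → X} (hc : D.ConstantOnFaces c) : D.Face → X :=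
  Quot.lift (fun x => c x.1 x.2) fun
    | _, _, .onLeft e => congrArg Prod.fst (hc e)
    | _, _, .onRight e => congrArg Prod.snd (hc e)

@[simp]
lemma ConstantOnFaces.lift_face {c : V → Fin 4 → X} (hc : D.ConstantOnFaces c) (v : V)
    (i : Fin 4) : hc.lift (D.face v i) = c v i :=
  rfl

variable (D) in
lemma overIn_eq_right_of_not_isPositive {v : V} (hv : ¬D.IsPositive v) :
    D.overIn v = Side.right := by
  cases ho : D.overIn v
  exacts [absurd ho hv, rfl]

end OrientedCode

/-! ### Sums over colourings -/

namespace Weights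

open OrientedCode

variable {R : Type*} [CommRing R] (w : Weights R)

/-- The variable of a crossing whose over-strand enters on the given side and whose four angles
have the given colours. -/
def crossingVar : Side → (Fin 4 → Fin 2) → R
  | Side.left, c => w.posVar (8 * (c 0).val + 4 * (c 1).val + 2 * (c 2).val + (c 3).val)
  | Side.right, c => w.negVar (8 * (c 0).val + 4 * (c 1).val + 2 * (c 2).val + (c 3).val)

lemma crossingVar_eq_zero {c : Fin 4 → Fin 2} {s : Side} (hleft : c (outLeft s) = 1)
    (hright : c (outRight s) = 1) (o : Side) : w.crossingVar o c = 0 := by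
  have vanish : ∀ i j : Fin 2,
      w.posVar (8 * i.val + 4 * 1 + 2 * 1 + j.val) = 0 ∧
      w.posVar (8 * i.val + 4 * j.val + 2 * 1 + 1) = 0 ∧
      w.negVar (8 * i.val + 4 * 1 + 2 * 1 + j.val) = 0 ∧
      w.negVar (8 * i.val + 4 * j.val + 2 * 1 + 1) = 0 := by
    intro i j
    fin_cases i <;> fin_cases j <;> exact ⟨rfl, rfl, rfl, rfl⟩
  cases s <;> cases o <;> simp only [outLeft, outRight] at hleft hright <;>
    simp only [crossingVar, hleft, hright, Fin.val_one, vanish]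

variable {w}

lemma sum_bigon_eq_ite (h : w.Equations2a) {s n W E : Fin 2} (hWs : ¬(W = 1 ∧ s = 1))
    (hsE : ¬(s = 1 ∧ E = 1)) :
    ∑ d : Fin 2, w.crossingVar Side.left ![s, E, d, W] * w.crossingVar Side.right ![d, E, n, W] *
      (w.faceVar d * (w.faceVar n * w.faceVar s)) = if n = s then w.faceVar s else 0 := by
  obtain ⟨h1, h2, h3, h4, h5, h6, h7⟩ := h
  rw [Fin.sum_univ_two]
  fin_cases s <;> fin_cases n <;> fin_cases W <;> fin_cases E <;>
    simp [crossingVar, posVar, negVar, faceVar] at hWs hsE ⊢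
  · linear_combination h1
  · linear_combination h6
  · linear_combination h3
  · linear_combination h7
  · linear_combination h4
  · linear_combination h2
  · linear_combination h5

lemma f0_mul_f1_mul_x4_mul_X4_sq (h5 : w.f0 ^ 3 * w.x5 * w.X5 = w.f0) (h3a : w.Equations3a) :
    w.f0 * (w.f1 * w.x4 * w.X4 ^ 2) = w.f0 * (w.f1 * w.x1 * w.X1 ^ 2) := by
  obtain ⟨e1, e2, e3, -, -, e6, -, -, e9, -⟩ := h3a
  have hX5 : w.f1 * w.x4 * w.X4 * w.X5 = w.f1 * w.x1 * w.X4 * w.X5 := by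
    linear_combination e9 - e2 + e6 - e3
  have hX4 : w.f1 * w.x1 * w.X4 ^ 2 = w.f1 * w.x1 * w.X1 ^ 2 := by
    linear_combination e1
  calc w.f0 * (w.f1 * w.x4 * w.X4 ^ 2)
      = w.f0 ^ 3 * w.x5 * w.X4 * (w.f1 * w.x4 * w.X4 * w.X5) := by
        linear_combination -(w.f1 * w.x4 * w.X4 ^ 2) * h5
    _ = w.f0 ^ 3 * w.x5 * w.X4 * (w.f1 * w.x1 * w.X4 * w.X5) := by rw [hX5]
    _ = w.f0 * (w.f1 * w.x1 * w.X4 ^ 2) := by linear_combination w.f1 * w.x1 * w.X4 ^ 2 * h5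
    _ = w.f0 * (w.f1 * w.x1 * w.X1 ^ 2) := by rw [hX4]

lemma sum_triangle_eq (h5 : w.f0 ^ 3 * w.x5 * w.X5 = w.f0) (h3a : w.Equations3a)
    (A B C P Q S : Fin 2) :
    w.faceVar A * ∑ t : Fin 2, w.faceVar t * (w.crossingVar Side.left ![C, t, A, P] *
        w.crossingVar Side.left ![A, t, B, Q] * w.crossingVar Side.right ![B, t, C, S]) =
      w.faceVar A * ∑ t : Fin 2, w.faceVar t * (w.crossingVar Side.left ![S, B, Q, t] *
        w.crossingVar Side.left ![P, C, S, t] * w.crossingVar Side.right ![Q, A, P, t]) := by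
  have white := f0_mul_f1_mul_x4_mul_X4_sq h5 h3a
  obtain ⟨-, -, e3, e4, e5, e6, e7, e8, e9, e10, e11, e12, e13, e14, e15, e16, e17, e18⟩ := h3a
  rw [Fin.sum_univ_two, Fin.sum_univ_two]
  -- The cases that survive are the colourings of the hexagon of faces `P, A, Q, B, S, C` around
  -- the triangle in which no two neighbours are black.
  fin_cases A <;> fin_cases B <;> fin_cases C <;> fin_cases P <;> fin_cases Q <;> fin_cases S <;>
    simp [crossingVar, posVar, negVar, faceVar]
  · linear_combination white
  · linear_combination w.f0 * e4
  · linear_combination w.f0 * (e9 + e6 - e3)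
  · linear_combination w.f0 * e5
  · linear_combination w.f0 * e9
  · linear_combination w.f0 * e12
  · linear_combination w.f0 * e10
  · linear_combination w.f0 * e13
  · linear_combination w.f0 * e6
  · linear_combination w.f0 * e7
  · linear_combination w.f0 * e3
  · linear_combination w.f0 * e11
  · linear_combination w.f0 * e8
  · linear_combination w.f1 * e14
  · linear_combination w.f1 * e16
  · linear_combination w.f1 * e17
  · linear_combination w.f1 * e15
  · linear_combination w.f1 * e18

variable {V V' Φ Φ' : Type*} [Fintype V] [Fintype V'] [Fintype Φ] [Fintype Φ']

lemma sum_bigon_mul_eq_ite (h : w.Equations2a) (o : V → Side) {k : V → Fin 4 → Option Φ} {S : Φ}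
    {W E : Option Φ} (hWS : ∃ e, outSides k e = (W, some S))
    (hSE : ∃ e, outSides k e = (some S, E)) (σ : Option Φ → Fin 2) :
    ∑ d : Fin 2, w.crossingVar Side.left ![σ (some S), σ E, d, σ W] *
        (w.crossingVar Side.right ![d, σ E, σ none, σ W] *
          ∏ v, w.crossingVar (o v) (σ ∘ k v)) *
        (w.faceVar d * (w.faceVar (σ none) * ∏ F, w.faceVar (σ (some F)))) =
      if σ none = σ (some S) then
        (∏ v, w.crossingVar (o v) (σ ∘ k v)) * ∏ F, w.faceVar (σ (some F)) else 0 := by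
  set K := ∏ v, w.crossingVar (o v) (σ ∘ k v)
  have K_eq_zero {x y : Option Φ} (he : ∃ e, outSides k e = (x, y)) (hxy : σ x = 1 ∧ σ y = 1) :
      K = 0 := by
    obtain ⟨e, he⟩ := he
    refine Finset.prod_eq_zero (Finset.mem_univ e.1) (w.crossingVar_eq_zero (s := e.2) ?_ ?_ _)
    · exact (congrArg σ (congrArg Prod.fst he)).trans hxy.1
    · exact (congrArg σ (congrArg Prod.snd he)).trans hxy.2
  by_cases hWS' : σ W = 1 ∧ σ (some S) = 1
  · simp [K_eq_zero hWS hWS']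
  by_cases hSE' : σ (some S) = 1 ∧ σ E = 1
  · simp [K_eq_zero hSE hSE']
  obtain ⟨M, hM⟩ := Finset.dvd_prod_of_mem (fun F => w.faceVar (σ (some F))) (Finset.mem_univ S)
  have pull (a b d n s : R) : a * (b * K) * (d * (n * (s * M))) =
      a * b * (d * (n * s)) * (K * M) := by ring
  simp only [hM, pull, ← Finset.sum_mul, sum_bigon_eq_ite h hWS' hSE']
  split_ifs <;> ring

variable [DecidableEq Φ] [DecidableEq Φ']

variable (w) in
/-- The state sum of a system of crossings `V` and faces `Φ`, in which the face at the angle `i`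
of the crossing `v` is `k v i`. It runs over all colourings of the faces, with no condition on
neighbours. -/
def faceSum (o : V → Side) (k : V → Fin 4 → Φ) : R :=
  ∑ σ : Φ → Fin 2, (∏ v, w.crossingVar (o v) (σ ∘ k v)) * ∏ F, w.faceVar (σ F)

variable (w) in
lemma faceSum_reindex (ε : V ≃ V') (φ : Φ ≃ Φ') (o : V' → Side) (k : V' → Fin 4 → Φ) :
    w.faceSum (o ∘ ε) (fun v => φ ∘ k (ε v)) = w.faceSum o k := by
  refine Fintype.sum_equiv (φ.symm.arrowCongr (Equiv.refl _)) _ _ fun σ => ?_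
  exact congrArg₂ (· * ·) (ε.prod_comp fun v => w.crossingVar (o v) (σ ∘ φ ∘ k v))
    (φ.prod_comp fun F => w.faceVar (σ F)).symm

lemma faceSum_option (o : V → Side) (k : V → Fin 4 → Option Φ) :
    w.faceSum o k = ∑ τ : Φ → Fin 2, ∑ t : Fin 2,
      (∏ v, w.crossingVar (o v) ((fun x => x.elim t τ) ∘ k v)) *
        (w.faceVar t * ∏ F, w.faceVar (τ F)) := by
  simp only [faceSum, sum_option_arrow, Fintype.prod_option, Option.elim_none, Option.elim_some]

lemma faceSum_triangle (h5 : w.f0 ^ 3 * w.x5 * w.X5 = w.f0) (h3a : w.Equations3a)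
    {o : V → Side} {p q r : V} (hpq : p ≠ q) (hqr : q ≠ r) (hpr : p ≠ r)
    (over_p : o p = Side.left) (over_q : o q = Side.left) (over_r : o r = Side.right)
    {k k' : V → Fin 4 → Option Φ} {A B C P Q S : Φ}
    (kp : k p = ![some C, none, some A, some P]) (kp' : k' p = ![some S, some B, some Q, none])
    (kq : k q = ![some A, none, some B, some Q]) (kq' : k' q = ![some P, some C, some S, none])
    (kr : k r = ![some B, none, some C, some S]) (kr' : k' r = ![some Q, some A, some P, none])
    (outer : ∀ v, v ≠ p → v ≠ q → v ≠ r → k' v = k v ∧ ∀ i, k v i ≠ none) :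
    w.faceSum o k = w.faceSum o k' := by
  classical
  rw [faceSum_option, faceSum_option]
  refine Finset.sum_congr rfl fun τ _ => ?_
  obtain ⟨M, hM⟩ := Finset.dvd_prod_of_mem (fun F => w.faceVar (τ F)) (Finset.mem_univ A)
  set K := ∏ v ∈ ({p, q, r} : Finset V)ᶜ, w.crossingVar (o v) ((fun x => x.elim 0 τ) ∘ k v)
  have outer_prod (c : V → Fin 4 → Option Φ) (t : Fin 2)
      (hc : ∀ v, v ≠ p → v ≠ q → v ≠ r → c v = k v) :
      ∏ v ∈ ({p, q, r} : Finset V)ᶜ, w.crossingVar (o v) ((fun x => x.elim t τ) ∘ c v) = K := by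
    refine Finset.prod_congr rfl fun v hv => congrArg _ (funext fun i => ?_)
    simp only [Finset.mem_compl, Finset.mem_insert, Finset.mem_singleton, not_or] at hv
    obtain ⟨F, hF⟩ := Option.ne_none_iff_exists'.1 ((outer v hv.1 hv.2.1 hv.2.2).2 i)
    simp only [hc v hv.1 hv.2.1 hv.2.2, Function.comp_apply, hF, Option.elim_some]
  have pull (a b c t : R) : a * b * c * K * (t * (w.faceVar (τ A) * M)) =
      w.faceVar (τ A) * (t * (a * b * c)) * (K * M) := by ring
  simp only [prod_eq_mul_mul_mul_prod_compl hpq hqr hpr, outer_prod k _ fun _ _ _ _ => rfl,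
    outer_prod k' _ fun v hp hq hr => (outer v hp hq hr).1, over_p, over_q, over_r, kp, kq, kr,
    kp', kq', kr', comp_vec_four, Option.elim_some, Option.elim_none, hM, pull, ← Finset.sum_mul,
    ← Finset.mul_sum]
  rw [sum_triangle_eq h5 h3a]

lemma faceSum_bigon (h : w.Equations2a) (o : V → Side) {k : V → Fin 4 → Option Φ} {S : Φ}
    {W E : Option Φ} (hWS : ∃ e, outSides k e = (W, some S))
    (hSE : ∃ e, outSides k e = (some S, E)) :
    w.faceSum (extendByTwo Side.left Side.right o)
        (extendByTwo ![some (some S), some E, none, some W] ![none, some E, some none, some W]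
          fun v => some ∘ k v) =
      w.faceSum o fun v i => (k v i).getD S := by
  have elim_getD (τ : Φ → Fin 2) (x : Option Φ) : x.elim (τ S) τ = τ (x.getD S) := by
    cases x <;> rfl
  have elim_comp_some (d : Fin 2) (σ : Option Φ → Fin 2) (v : V) :
      (fun x => x.elim d σ) ∘ some ∘ k v = σ ∘ k v := rfl
  rw [faceSum_option]
  simp only [Fintype.prod_option (α := Option V), Fintype.prod_option (α := V),
    Fintype.prod_option (α := Φ), extendByTwo, Option.elim_none, Option.elim_some, elim_comp_some,
    comp_vec_four, sum_bigon_mul_eq_ite h o hWS hSE, sum_option_arrow]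
  refine Finset.sum_congr rfl fun τ _ => (Fintype.sum_ite_eq' (τ S) _).trans ?_
  simp only [Function.comp_def, elim_getD]

end Weights

namespace LinkDiagram

open OrientedCode

variable {V : Type*} [Fintype V]

lemma stateSum_eq_faceSum {R : Type*} [CommRing R] (w : Weights R) (D : LinkDiagram V)
    [DecidableEq D.Face] : D.stateSum w = w.faceSum D.overIn D.face := by
  refine Finset.sum_of_injOn (fun σ : D.State => σ.1) Subtype.val_injective.injOn
    (by simp) (fun σ _ not_state => ?_) fun σ _ => ?_
  · have : ∃ e, σ (D.leftFace e) = 1 ∧ σ (D.rightFace e) = 1 := by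
      by_contra! h
      exact not_state ⟨⟨σ, fun e he => h e he.1 he.2⟩, Finset.mem_coe.2 (Finset.mem_univ _), rfl⟩
    obtain ⟨e, hleft, hright⟩ := this
    rw [Finset.prod_eq_zero (Finset.mem_univ e.1) (w.crossingVar_eq_zero hleft hright _), zero_mul]
  · refine congrArg (· * _) (Finset.prod_congr rfl fun v _ => ?_)
    unfold IsPositive
    cases D.overIn v
    · exact if_pos rfl
    · exact if_neg Side.noConfusion

end LinkDiagram

/-! ### The move 3a -/

namespace OrientedCode

variable {V X : Type*}

/-- The ends on the right at `p`, `q` and `r`. For a clockwise triangle they are the outgoing ends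
where its edges start, and also the incoming ends where its edges arrive. -/
def rightEnds (p q r : V) : Set (V × Side) :=
  {(p, Side.right), (q, Side.right), (r, Side.right)}

/-- The crossings `p`, `q`, `r` are the vertices of a triangular face of `D`, whose edges run
clockwise from `p` to `q` to `r` to `p`. The angle of the triangle at each of them has the
number `1`. -/
structure IsClockwiseTriangle (D : OrientedCode V) (p q r : V) : Prop where
  p_ne_q : p ≠ q
  q_ne_r : q ≠ r
  p_ne_r : p ≠ r
  next_p : D.next (p, Side.right) = (q, Side.right)
  next_q : D.next (q, Side.right) = (r, Side.right)
  next_r : D.next (r, Side.right) = (p, Side.right)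

open Classical in
/-- The effect of the move 3a on a labelling of the angles coming from a labelling of the faces.
The faces outside the triangle keep their labels, and the new triangle takes over the label of the
old one; its angle at each of `p`, `q`, `r` has the number `3`. -/
noncomputable def flipTriangle (p q r : V) (c : V → Fin 4 → X) (v : V) : Fin 4 → X :=
  if v = p then ![c r 3, c q 2, c q 3, c p 1]
  else if v = q then ![c p 3, c r 2, c r 3, c q 1]
  else if v = r then ![c q 3, c p 2, c p 3, c r 1]
  else c v

lemma flipTriangle_first (p q r : V) (c : V → Fin 4 → X) :
    flipTriangle p q r c p = ![c r 3, c q 2, c q 3, c p 1] :=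
  if_pos rfl

lemma flipTriangle_of_ne {p q r v : V} (hp : v ≠ p) (hq : v ≠ q) (hr : v ≠ r)
    (c : V → Fin 4 → X) : flipTriangle p q r c v = c v := by
  simp [flipTriangle, hp, hq, hr]

lemma eq_left_or_ne_of_notMem_rightEnds {p q r : V} {e : V × Side} (he : e ∉ rightEnds p q r) :
    e = (p, Side.left) ∨ e = (q, Side.left) ∨ e = (r, Side.left) ∨
      (e.1 ≠ p ∧ e.1 ≠ q ∧ e.1 ≠ r) := by
  obtain ⟨v, _ | _⟩ := e <;> simp [rightEnds] at he ⊢ <;> tauto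

namespace IsClockwiseTriangle

variable {D : OrientedCode V} {p q r : V} (h : D.IsClockwiseTriangle p q r)
include h

lemma flipTriangle_second (c : V → Fin 4 → X) :
    flipTriangle p q r c q = ![c p 3, c r 2, c r 3, c q 1] := by
  simp [flipTriangle, h.p_ne_q.symm]

lemma flipTriangle_third (c : V → Fin 4 → X) :
    flipTriangle p q r c r = ![c q 3, c p 2, c p 3, c r 1] := by
  simp [flipTriangle, h.p_ne_r.symm, h.q_ne_r.symm]

lemma next_mem_rightEnds {e : V × Side} : D.next e ∈ rightEnds p q r ↔ e ∈ rightEnds p q r := by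
  have image_eq : D.next '' rightEnds p q r = rightEnds p q r := by
    simp only [rightEnds, Set.image_insert_eq, Set.image_singleton, h.next_p, h.next_q, h.next_r]
    grind
  rw [← D.next.injective.mem_set_image (a := e), image_eq]

lemma faces_around {c : V → Fin 4 → X} (hc : D.ConstantOnFaces c) :
    (c p 2 = c q 0 ∧ c p 1 = c q 1) ∧ (c q 2 = c r 0 ∧ c q 1 = c r 1) ∧
      (c r 2 = c p 0 ∧ c r 1 = c p 1) := by
  have hp := hc (p, Side.right)
  have hq := hc (q, Side.right)
  have hr := hc (r, Side.right)
  rw [h.next_p] at hp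
  rw [h.next_q] at hq
  rw [h.next_r] at hr
  exact ⟨Prod.ext_iff.1 hp, Prod.ext_iff.1 hq, Prod.ext_iff.1 hr⟩

lemma face_eq_iff {v : V} {i : Fin 4} :
    D.face v i = D.face p 1 ↔ (v, Side.right) ∈ rightEnds p q r ∧ i = 1 := by
  have onTriangle : D.ConstantOnFaces fun v i => (v, Side.right) ∈ rightEnds p q r ∧ i = 1 := by
    intro e
    have := h.next_mem_rightEnds (e := e)
    rcases e with ⟨v, _ | _⟩ <;> rcases hn : D.next _ with ⟨u, _ | _⟩ <;> rw [hn] at this <;>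
      simp_all [outSides, inSides, outLeft, outRight, inLeft, inRight, rightEnds]
  constructor
  · intro hF
    simpa [rightEnds] using congrArg onTriangle.lift hF
  · obtain ⟨⟨-, hp⟩, -, -, hr⟩ := h.faces_around D.constantOnFaces_face
    simp only [rightEnds, Set.mem_insert_iff, Set.mem_singleton_iff, Prod.mk.injEq, and_true]
    rintro ⟨rfl | rfl | rfl, rfl⟩
    exacts [rfl, hp.symm, hr]

lemma swapOut_apply :
    LinkDiagram.swapOut p q r (p, Side.left) = (r, Side.right) ∧
    LinkDiagram.swapOut p q r (q, Side.left) = (p, Side.right) ∧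
    LinkDiagram.swapOut p q r (r, Side.left) = (q, Side.right) ∧
    LinkDiagram.swapOut p q r (p, Side.right) = (q, Side.left) ∧
    LinkDiagram.swapOut p q r (q, Side.right) = (r, Side.left) ∧
    LinkDiagram.swapOut p q r (r, Side.right) = (p, Side.left) := by
  simp [LinkDiagram.swapOut, Equiv.swap_apply_def, h.p_ne_q, h.q_ne_r, h.p_ne_r, h.p_ne_q.symm,
    h.q_ne_r.symm, h.p_ne_r.symm]

lemma swapIn_apply :
    LinkDiagram.swapIn p q r (p, Side.left) = (q, Side.right) ∧
    LinkDiagram.swapIn p q r (q, Side.left) = (r, Side.right) ∧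
    LinkDiagram.swapIn p q r (r, Side.left) = (p, Side.right) ∧
    LinkDiagram.swapIn p q r (p, Side.right) = (r, Side.left) ∧
    LinkDiagram.swapIn p q r (q, Side.right) = (p, Side.left) ∧
    LinkDiagram.swapIn p q r (r, Side.right) = (q, Side.left) := by
  simp [LinkDiagram.swapIn, Equiv.swap_apply_def, h.p_ne_q, h.q_ne_r, h.p_ne_r, h.p_ne_q.symm,
    h.q_ne_r.symm, h.p_ne_r.symm]

lemma outSides_flipTriangle_swapOut (c : V → Fin 4 → X) {e : V × Side}
    (he : e ∉ rightEnds p q r) :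
    outSides (flipTriangle p q r c) (LinkDiagram.swapOut p q r e) = outSides c e := by
  obtain ⟨swap_p, swap_q, swap_r, -⟩ := h.swapOut_apply
  obtain rfl | rfl | rfl | ⟨hp, hq, hr⟩ := eq_left_or_ne_of_notMem_rightEnds he
  · simp [swap_p, outSides, outLeft, outRight, h.flipTriangle_third]
  · simp [swap_q, outSides, outLeft, outRight, flipTriangle_first]
  · simp [swap_r, outSides, outLeft, outRight, h.flipTriangle_second]
  · simp [outSides, LinkDiagram.swapOut, Equiv.swap_apply_of_ne_of_ne, Prod.ext_iff, hp, hq, hr,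
      flipTriangle_of_ne]

lemma inSides_flipTriangle_swapIn {c : V → Fin 4 → X} (hc : D.ConstantOnFaces c) {e : V × Side}
    (he : e ∉ rightEnds p q r) :
    inSides (flipTriangle p q r c) (LinkDiagram.swapIn p q r e) = inSides c e := by
  obtain ⟨hp, hq, hr⟩ := h.faces_around hc
  obtain ⟨swap_p, swap_q, swap_r, -⟩ := h.swapIn_apply
  obtain rfl | rfl | rfl | ⟨hp, hq, hr⟩ := eq_left_or_ne_of_notMem_rightEnds he
  · simp [swap_p, inSides, inLeft, inRight, h.flipTriangle_second, hr]
  · simp [swap_q, inSides, inLeft, inRight, h.flipTriangle_third, hp]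
  · simp [swap_r, inSides, inLeft, inRight, flipTriangle_first, hq]
  · simp [inSides, LinkDiagram.swapIn, Equiv.swap_apply_of_ne_of_ne, Prod.ext_iff, hp, hq, hr,
      flipTriangle_of_ne]

lemma outSides_swapOut_eq_inSides_swapIn {c : V → Fin 4 → X} (hc : D.ConstantOnFaces c)
    (e : V × Side) :
    outSides (flipTriangle p q r c) (LinkDiagram.swapOut p q r e) =
      inSides (flipTriangle p q r c) (LinkDiagram.swapIn p q r (D.next e)) := by
  by_cases he : e ∈ rightEnds p q r
  · obtain ⟨⟨-, hp⟩, ⟨-, hq⟩, -, hr⟩ := h.faces_around hc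
    obtain ⟨-, -, -, out_p, out_q, out_r⟩ := h.swapOut_apply
    obtain ⟨-, -, -, in_p, in_q, in_r⟩ := h.swapIn_apply
    rcases he with rfl | rfl | rfl
    · simp [h.next_p, out_p, in_q, outSides, inSides, outLeft, outRight, inLeft, inRight,
        flipTriangle_first, h.flipTriangle_second, hp]
    · simp [h.next_q, out_q, in_r, outSides, inSides, outLeft, outRight, inLeft, inRight,
        h.flipTriangle_second, h.flipTriangle_third, hq]
    · simp [h.next_r, out_r, in_p, outSides, inSides, outLeft, outRight, inLeft, inRight,
        h.flipTriangle_third, flipTriangle_first, hr]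
  · rw [h.outSides_flipTriangle_swapOut c he, hc,
      h.inSides_flipTriangle_swapIn hc (mt h.next_mem_rightEnds.1 he)]

lemma exists_flipTriangle_eq {c : V → Fin 4 → X} (hc : D.ConstantOnFaces c) (v : V) (i : Fin 4) :
    ∃ u j, flipTriangle p q r c u j = c v i := by
  obtain ⟨⟨hp, -⟩, ⟨hq, -⟩, hr, -⟩ := h.faces_around hc
  have first := flipTriangle_first p q r c
  have second := h.flipTriangle_second c
  have third := h.flipTriangle_third c
  by_cases hvp : v = p
  · subst hvp
    fin_cases i
    exacts [⟨q, 1, by simp [second, hr]⟩, ⟨v, 3, by simp [first]⟩, ⟨r, 1, by simp [third]⟩,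
      ⟨q, 0, by simp [second]⟩]
  by_cases hvq : v = q
  · subst hvq
    fin_cases i
    exacts [⟨r, 1, by simp [third, hp]⟩, ⟨v, 3, by simp [second]⟩, ⟨p, 1, by simp [first]⟩,
      ⟨r, 0, by simp [third]⟩]
  by_cases hvr : v = r
  · subst hvr
    fin_cases i
    exacts [⟨p, 1, by simp [first, hq]⟩, ⟨v, 3, by simp [third]⟩, ⟨q, 1, by simp [second]⟩,
      ⟨p, 0, by simp [first]⟩]
  · exact ⟨v, i, by rw [flipTriangle_of_ne hvp hvq hvr]⟩

end IsClockwiseTriangle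

end OrientedCode

namespace OrientedCode.IsClockwiseTriangle

variable {V : Type*} [Fintype V] {D : OrientedCode V} {p q r : V}

lemma faceSum_flipTriangle [DecidableEq D.Face] {R : Type*} [CommRing R] {w : Weights R}
    (h5 : w.f0 ^ 3 * w.x5 * w.X5 = w.f0) (h3a : w.Equations3a) (h : D.IsClockwiseTriangle p q r)
    (over_p : D.overIn p = Side.left) (over_q : D.overIn q = Side.left)
    (over_r : D.overIn r = Side.right) :
    w.faceSum D.overIn (flipTriangle p q r D.face) = w.faceSum D.overIn D.face := by
  obtain ⟨⟨hp2, hp1⟩, ⟨hq2, -⟩, hr2, hr1⟩ := h.faces_around D.constantOnFaces_face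
  set T := D.face p 1 with hT
  let g : D.Face ≃ Option {F // F ≠ T} := (Equiv.optionSubtypeNe T).symm
  have g_T : g T = none := Equiv.optionSubtypeNe_symm_self T
  have g_ne (v : V) (i : Fin 4) (hvi : ¬((v, Side.right) ∈ rightEnds p q r ∧ i = 1)) :
      ∃ F, g (D.face v i) = some F :=
    ⟨_, Equiv.optionSubtypeNe_symm_of_ne (mt h.face_eq_iff.1 hvi)⟩
  obtain ⟨A, hA⟩ := g_ne p 2 (by simp)
  obtain ⟨B, hB⟩ := g_ne q 2 (by simp)
  obtain ⟨C, hC⟩ := g_ne r 2 (by simp)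
  obtain ⟨P, hP⟩ := g_ne p 3 (by simp)
  obtain ⟨Q, hQ⟩ := g_ne q 3 (by simp)
  obtain ⟨S, hS⟩ := g_ne r 3 (by simp)
  have g_row (v : V) : g ∘ D.face v =
      ![g (D.face v 0), g (D.face v 1), g (D.face v 2), g (D.face v 3)] := by
    funext i
    fin_cases i <;> rfl
  rw [← w.faceSum_reindex (Equiv.refl V) g, ← w.faceSum_reindex (Equiv.refl V) g]
  refine (Weights.faceSum_triangle h5 h3a (A := A) (B := B) (C := C) (P := P) (Q := Q) (S := S)
    h.p_ne_q h.q_ne_r h.p_ne_r over_p over_q over_r ?_ ?_ ?_ ?_ ?_ ?_ ?_).symm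
  · simp [g_row, ← hr2, hA, hC, hP, ← hT, g_T]
  · simp [flipTriangle_first, comp_vec_four, hS, hB, hQ, ← hT, g_T]
  · simp [g_row, ← hp2, ← hp1, hA, hB, hQ, g_T]
  · simp [h.flipTriangle_second, comp_vec_four, ← hp1, hP, hC, hS, g_T]
  · simp [g_row, ← hq2, hr1, hB, hC, hS, g_T]
  · simp [h.flipTriangle_third, comp_vec_four, hr1, hQ, hA, hP, g_T]
  · intro v hp hq hr
    have hv (i : Fin 4) := g_ne v i (by simp [rightEnds, hp, hq, hr])
    simp [flipTriangle_of_ne hp hq hr, Option.ne_none_iff_exists', hv]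

end OrientedCode.IsClockwiseTriangle

namespace LinkDiagram

variable {V V' : Type*}

open OrientedCode

lemma exists_face_equiv_flipTriangle [Finite V'] {D : LinkDiagram V} {D' : LinkDiagram V'}
    {p q r : V} (h : D.IsClockwiseTriangle p q r) (ε : V ≃ V')
    (hnext : ∀ e : V × Side,
      D'.next (Prod.map ε id (swapOut p q r e)) = Prod.map ε id (swapIn p q r (D.next e))) :
    ∃ φ : D'.Face ≃ D.Face, ∀ v, φ ∘ D'.face (ε v) = flipTriangle p q r D.face v := by
  have hc : D'.ConstantOnFaces fun v => flipTriangle p q r D.face (ε.symm v) := by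
    intro e'
    obtain ⟨e, rfl⟩ := ((swapOut p q r).trans (ε.prodCongr (Equiv.refl Side))).surjective e'
    change outSides _ (Prod.map ε id (swapOut p q r e)) =
      inSides _ (D'.next (Prod.map ε id (swapOut p q r e)))
    rw [hnext]
    simpa [outSides, inSides] using
      h.outSides_swapOut_eq_inSides_swapIn D.constantOnFaces_face e
  have surj : Function.Surjective hc.lift := by
    rintro ⟨v, i⟩
    change ∃ F, hc.lift F = D.face v i
    obtain ⟨u, j, huj⟩ := h.exists_flipTriangle_eq D.constantOnFaces_face v i
    exact ⟨D'.face (ε u) j, by simpa using huj⟩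
  have card_le : Nat.card D'.Face ≤ Nat.card D.Face := by
    rw [D.planar, D'.planar, Nat.card_congr ε]
  refine ⟨Equiv.ofBijective _ (surj.bijective_of_nat_card_le card_le), fun v => ?_⟩
  funext i
  simp

lemma stateSum_eq_of_isMove3a [Fintype V] [Fintype V'] {R : Type*} [CommRing R] {w : Weights R}
    (h5 : w.f0 ^ 3 * w.x5 * w.X5 = w.f0) (h3a : w.Equations3a) {D : LinkDiagram V}
    {D' : LinkDiagram V'} (h : D.IsMove3a D') : D.stateSum w = D'.stateSum w := by
  classical
  obtain ⟨p, q, r, hpq, hqr, hpr, pos_p, pos_q, neg_r, next_p, next_q, next_r, ε, hover, hnext⟩ :=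
    h
  have triangle : D.IsClockwiseTriangle p q r := ⟨hpq, hqr, hpr, next_p, next_q, next_r⟩
  have over_r := D.overIn_eq_right_of_not_isPositive neg_r
  obtain ⟨φ, hφ⟩ := exists_face_equiv_flipTriangle triangle ε hnext
  calc D.stateSum w = w.faceSum D.overIn D.face := stateSum_eq_faceSum w D
    _ = w.faceSum D.overIn (flipTriangle p q r D.face) :=
      (triangle.faceSum_flipTriangle h5 h3a pos_p pos_q over_r).symm
    _ = w.faceSum (D'.overIn ∘ ε) fun v => φ ∘ D'.face (ε v) := by
      simp only [hφ, Function.comp_def, hover]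
    _ = w.faceSum D'.overIn D'.face := w.faceSum_reindex ε φ _ _
    _ = D'.stateSum w := (stateSum_eq_faceSum w D').symm

end LinkDiagram

/-! ### The move 2a -/

namespace LinkDiagram

open OrientedCode

variable {V V' : Type*}

lemma mem_of_next_mem [Finite V] (D : LinkDiagram V) {Z : Set V} {u : V} (hu : u ∈ Z)
    (hZ : ∀ v ∈ Z, ∀ s, (D.next (v, s)).1 ∈ Z) (v : V) : v ∈ Z := by
  -- A permutation of a finite set that maps a subset into itself permutes it.
  have mem_iff (x : V) (s : Side) : (D.next (x, s)).1 ∈ Z ↔ x ∈ Z := by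
    refine ⟨fun h => ?_, fun h => hZ x h s⟩
    simpa using Equiv.Perm.perm_symm_on_of_perm_on_finite (f := D.next) (p := fun e => e.1 ∈ Z)
      (fun e he => hZ e.1 he e.2) h
  have : ∀ x y, Relation.EqvGen (fun x y => ∃ s : Side, (D.next (x, s)).1 = y) x y →
      (x ∈ Z ↔ y ∈ Z) := by
    intro x y hxy
    induction hxy with
    | rel x y hxy =>
      obtain ⟨s, rfl⟩ := hxy
      exact (mem_iff x s).symm
    | refl => rfl
    | symm _ _ _ ih => exact ih.symm
    | trans _ _ _ _ _ ih₁ ih₂ => exact ih₁.trans ih₂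
  exact (this u v (D.connected u v)).1 hu

/-- The geometric part of the move 2a: `a` is the lower and `b` the upper vertex of a bigon of `D`
whose two strands go upwards, the faces above and below it are distinct, and `D'` arises from `D`
by pulling the two strands apart. The equivalence `ι` identifies the crossings of `D'` with the
other crossings of `D`. -/
structure IsBigonRemoval (D : LinkDiagram V) (D' : LinkDiagram V') (a b : V)
    (ι : V' ≃ {v : V // v ≠ a ∧ v ≠ b}) : Prop where
  next_lower : ∀ s, D.next (a, s) = (b, s)
  above_ne_below : D.face b 2 ≠ D.face a 0
  next_eq_skipBigon : ∀ e : V' × Side,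
    ((ι (D'.next e).1 : V), (D'.next e).2) = D.skipBigon a b (D.next (ι e.1, e.2))

namespace IsBigonRemoval

variable {D : LinkDiagram V} {D' : LinkDiagram V'} {a b : V} {ι : V' ≃ {v : V // v ≠ a ∧ v ≠ b}}
  (h : D.IsBigonRemoval D' a b ι)
include h

lemma faces_around :
    D.face a 2 = D.face b 0 ∧ D.face a 3 = D.face b 3 ∧ D.face a 1 = D.face b 1 := by
  have hleft := D.constantOnFaces_face (a, Side.left)
  have hright := D.constantOnFaces_face (a, Side.right)
  rw [h.next_lower] at hleft hright
  exact ⟨congrArg Prod.snd hleft, congrArg Prod.fst hleft, congrArg Prod.snd hright⟩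

lemma lower_ne_upper : a ≠ b := by
  rintro rfl
  exact h.above_ne_below h.faces_around.1

lemma next_upper_ne (s : Side) : D.next (b, s) ≠ (a, s) := by
  intro hs
  have hfaces := D.constantOnFaces_face (b, s)
  rw [hs] at hfaces
  cases s
  · exact h.above_ne_below (congrArg Prod.snd hfaces)
  · exact h.above_ne_below (congrArg Prod.fst hfaces)

lemma exists_next_eq_lower [Finite V] (t : Side) : ∃ v s, D.next (ι v, s) = (a, t) := by
  have outside_or_upper (t : Side) :
      (∃ v s, D.next (ι v, s) = (a, t)) ∨ ∃ s, D.next (b, s) = (a, t) := by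
    obtain ⟨⟨u, s⟩, hu⟩ := D.next.surjective (a, t)
    by_cases hub : u = b
    · exact .inr ⟨s, hub ▸ hu⟩
    have hua : u ≠ a := by
      rintro rfl
      exact h.lower_ne_upper (congrArg Prod.fst ((h.next_lower s).symm.trans hu)).symm
    exact .inl ⟨ι.symm ⟨u, hua, hub⟩, s, by simpa using hu⟩
  obtain outside | ⟨s, hs⟩ := outside_or_upper t
  · exact outside
  exfalso
  obtain ⟨v, s', hv⟩ | ⟨s', hs'⟩ := outside_or_upper s
  · have skip := h.next_eq_skipBigon (v, s')
    rw [hv, skipBigon, if_pos rfl, hs] at skip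
    exact (ι _).2.1 (congrArg Prod.fst skip)
  -- Now both edges leaving `b` arrive at `a`, so that `a` and `b` form a component of `D`.
  have s_ne : s' ≠ s := by
    rintro rfl
    exact h.next_upper_ne s' hs'
  obtain ⟨v⟩ := D'.nonempty
  have hv := D.mem_of_next_mem (Z := {a, b}) (Set.mem_insert a _) ?_ (ι v)
  · exact hv.elim (ι v).2.1 (ι v).2.2
  rintro _ (rfl | rfl) x
  · simp [h.next_lower]
  · obtain rfl | rfl : x = s ∨ x = s' := by
      cases x <;> cases s <;> cases s' <;> simp_all
    · simp [hs]
    · simp [hs']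

lemma exists_face_eq_lower [Finite V] (t : Side) : ∃ v s,
    D.face (ι v) (outLeft s) = D.face a (inLeft t) ∧
      D.face (ι v) (outRight s) = D.face a (inRight t) := by
  obtain ⟨v, s, hvs⟩ := h.exists_next_eq_lower t
  have hfaces := D.constantOnFaces_face (ι v, s)
  rw [hvs] at hfaces
  exact ⟨v, s, Prod.ext_iff.1 hfaces⟩

variable [DecidableEq D.Face]

lemma map_inSides_skipBigon (f : V × Side) :
    Prod.map (Function.update id (D.face b 2) (D.face a 0))
        (Function.update id (D.face b 2) (D.face a 0)) (inSides D.face (D.skipBigon a b f)) =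
      Prod.map (Function.update id (D.face b 2) (D.face a 0))
        (Function.update id (D.face b 2) (D.face a 0)) (inSides D.face f) := by
  obtain ⟨u, t⟩ := f
  obtain ⟨-, left, right⟩ := h.faces_around
  by_cases hu : u = a
  · subst hu
    rw [skipBigon, if_pos rfl, ← D.constantOnFaces_face]
    cases t <;> simp [outSides, inSides, outLeft, outRight, inLeft, inRight, left, right,
      Function.update_of_ne h.above_ne_below.symm]
  · rw [skipBigon, if_neg hu]

lemma constantOnFaces_update : D'.ConstantOnFaces fun v =>
    Function.update id (D.face b 2) (D.face a 0) ∘ D.face (ι v) := by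
  intro e
  have houter := congrArg (Prod.map (Function.update id (D.face b 2) (D.face a 0))
    (Function.update id (D.face b 2) (D.face a 0))) (D.constantOnFaces_face (ι e.1, e.2))
  rw [← h.map_inSides_skipBigon, ← h.next_eq_skipBigon] at houter
  exact houter

/-- The face of `D` given by a face of `D'`; of the two faces above and below the bigon, which
become one face of `D'`, the lower one is taken. -/
def faceMap : D'.Face → D.Face :=
  h.constantOnFaces_update.lift

lemma faceMap_face (v : V') (i : Fin 4) : h.faceMap (D'.face v i) =
    Function.update id (D.face b 2) (D.face a 0) (D.face (ι v) i) :=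
  rfl

lemma exists_extendByTwo_eq_face (v : V') (i : Fin 4) :
    ∃ x, extendByTwo (D.face a 2) (D.face b 2) h.faceMap (some x) = D.face (ι v) i ∧
      ∀ S, h.faceMap S = D.face a 0 → h.faceMap (x.getD S) = h.faceMap (D'.face v i) := by
  by_cases above : D.face (ι v) i = D.face b 2
  · exact ⟨none, above.symm, fun S hS => by simp [faceMap_face, above, hS]⟩
  · refine ⟨some (D'.face v i), ?_, fun _ _ => rfl⟩
    simp [extendByTwo, faceMap_face, Function.update_of_ne above]

lemma extendByTwo_faceMap_surjective [Finite V] :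
    Function.Surjective (extendByTwo (D.face a 2) (D.face b 2) h.faceMap) := by
  have outer (v : V') (i : Fin 4) :
      D.face (ι v) i ∈ Set.range (extendByTwo (D.face a 2) (D.face b 2) h.faceMap) := by
    obtain ⟨x, hx, -⟩ := h.exists_extendByTwo_eq_face v i
    exact ⟨some x, hx⟩
  have below (t : Side) :
      D.face a (inLeft t) ∈ Set.range (extendByTwo (D.face a 2) (D.face b 2) h.faceMap) ∧
      D.face a (inRight t) ∈ Set.range (extendByTwo (D.face a 2) (D.face b 2) h.faceMap) := by
    obtain ⟨v, s, hleft, hright⟩ := h.exists_face_eq_lower t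
    exact ⟨hleft ▸ outer v _, hright ▸ outer v _⟩
  obtain ⟨bigon, left, right⟩ := h.faces_around
  rintro ⟨v, i⟩
  change D.face v i ∈ Set.range _
  by_cases ha : v = a
  · subst ha
    fin_cases i
    exacts [(below Side.left).2, (below Side.right).2, ⟨none, rfl⟩, (below Side.left).1]
  by_cases hb : v = b
  · subst hb
    fin_cases i
    exacts [⟨none, bigon⟩, right ▸ (below Side.right).2, ⟨some none, rfl⟩,
      left ▸ (below Side.left).1]
  · simpa using outer (ι.symm ⟨v, ha, hb⟩) i

lemma extendByTwo_faceMap_bijective [Finite V] [Finite V'] :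
    Function.Bijective (extendByTwo (D.face a 2) (D.face b 2) h.faceMap) := by
  refine h.extendByTwo_faceMap_surjective.bijective_of_nat_card_le ?_
  rw [Finite.card_option, Finite.card_option, D.planar, D'.planar,
    ← Nat.card_congr (Equiv.ofBijective _ (extendByTwo_bijective h.lower_ne_upper ι)),
    Finite.card_option, Finite.card_option]

omit [DecidableEq D.Face] in
lemma exists_face_equiv [Finite V] [Finite V'] :
    ∃ (φ : D.Face ≃ Option (Option D'.Face)) (k : V' → Fin 4 → Option D'.Face) (S : D'.Face)
      (W E : Option D'.Face),
      (φ ∘ D.face a = ![some (some S), some E, none, some W] ∧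
        φ ∘ D.face b = ![none, some E, some none, some W] ∧
        ∀ v, φ ∘ D.face (ι v) = some ∘ k v) ∧
      ((∃ e, outSides k e = (W, some S)) ∧ ∃ e, outSides k e = (some S, E)) ∧
      ∀ v i, (k v i).getD S = D'.face v i := by
  classical
  let ψ := Equiv.ofBijective _ h.extendByTwo_faceMap_bijective
  choose k hk k_getD using h.exists_extendByTwo_eq_face
  have arriving (t : Side) : ∃ e x y, outSides k e = (x, y) ∧ ψ (some x) = D.face a (inLeft t) ∧
      ψ (some y) = D.face a (inRight t) := by
    obtain ⟨v, s, hleft, hright⟩ := h.exists_face_eq_lower t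
    exact ⟨(v, s), _, _, rfl, (hk v _).trans hleft, (hk v _).trans hright⟩
  obtain ⟨eW, W, S', hWS, hW, hS'⟩ := arriving Side.left
  obtain ⟨eE, S'', E, hSE, hS'', hE⟩ := arriving Side.right
  obtain rfl : S' = S'' := Option.some_injective _ (ψ.injective (hS'.trans hS''.symm))
  obtain ⟨S, rfl⟩ : ∃ S, S' = some S := by
    refine Option.ne_none_iff_exists'.1 ?_
    rintro rfl
    exact h.above_ne_below hS'
  obtain ⟨bigon, left, right⟩ := h.faces_around
  refine ⟨ψ.symm, k, S, W, E, ⟨funext fun i => ψ.symm_apply_eq.2 ?_,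
    funext fun i => ψ.symm_apply_eq.2 ?_, fun v => funext fun i => ψ.symm_apply_eq.2 (hk v i).symm⟩,
    ⟨⟨eW, hWS⟩, eE, hSE⟩, fun v i => ?_⟩
  · fin_cases i
    exacts [hS'.symm, hE.symm, rfl, hW.symm]
  · fin_cases i
    exacts [bigon.symm, right.symm.trans hE.symm, rfl, left.symm.trans hW.symm]
  · have faceMap_injective : Function.Injective h.faceMap :=
      ψ.injective.comp ((Option.some_injective _).comp (Option.some_injective _))
    exact faceMap_injective (k_getD v i S hS')

omit [DecidableEq D.Face] in
lemma stateSum_eq [Fintype V] [Fintype V'] {R : Type*} [CommRing R] {w : Weights R}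
    (h2a : w.Equations2a) (over_a : D.overIn a = Side.left) (over_b : D.overIn b = Side.right)
    (over_ι : ∀ v, D'.overIn v = D.overIn (ι v)) : D.stateSum w = D'.stateSum w := by
  classical
  let e := Equiv.ofBijective _ (extendByTwo_bijective h.lower_ne_upper ι)
  obtain ⟨φ, k, S, W, E, ⟨φ_a, φ_b, φ_ι⟩, ⟨hWS, hSE⟩, k_getD⟩ := h.exists_face_equiv
  have over_e : D.overIn ∘ e = extendByTwo Side.left Side.right D'.overIn := by
    funext x
    obtain _ | _ | v := x
    exacts [over_a, over_b, (over_ι v).symm]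
  have face_e : (fun x => φ ∘ D.face (e x)) = extendByTwo ![some (some S), some E, none, some W]
      ![none, some E, some none, some W] fun v => some ∘ k v := by
    funext x
    obtain _ | _ | v := x
    exacts [φ_a, φ_b, φ_ι v]
  calc D.stateSum w = w.faceSum D.overIn D.face := stateSum_eq_faceSum w D
    _ = w.faceSum (D.overIn ∘ e) fun x => φ ∘ D.face (e x) := (w.faceSum_reindex e φ _ _).symm
    _ = w.faceSum D'.overIn fun v i => (k v i).getD S := by
      rw [over_e, face_e, Weights.faceSum_bigon h2a _ hWS hSE]
    _ = w.faceSum D'.overIn D'.face := by simp only [k_getD]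
    _ = D'.stateSum w := (stateSum_eq_faceSum w D').symm

end IsBigonRemoval

lemma stateSum_eq_of_isMove2a [Fintype V] [Fintype V'] {R : Type*} [CommRing R] {w : Weights R}
    (h2a : w.Equations2a) {D : LinkDiagram V} {D' : LinkDiagram V'} (h : D.IsMove2a D') :
    D.stateSum w = D'.stateSum w := by
  obtain ⟨a, b, pos_a, neg_b, next_left, next_right, above_ne_below, ι, over_ι, hnext⟩ := h
  have removal : D.IsBigonRemoval D' a b ι :=
    ⟨fun s => s.casesOn next_left next_right, above_ne_below, fun e => hnext e.1 e.2⟩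
  exact removal.stateSum_eq h2a pos_a (D.overIn_eq_right_of_not_isPositive neg_b) over_ι

end LinkDiagram

theorem mainTheorem2 {R : Type*} [CommRing R] (w : Weights R)
    (h2a : w.Equations2a) (h3a : w.Equations3a) {V V' : Type*} [Fintype V] [Fintype V']
    (D : LinkDiagram V) (D' : LinkDiagram V') :
    (D.IsMove2a D' → D.stateSum w = D'.stateSum w) ∧
      (D.IsMove3a D' → D.stateSum w = D'.stateSum w) :=
  ⟨LinkDiagram.stateSum_eq_of_isMove2a h2a,
    LinkDiagram.stateSum_eq_of_isMove3a h2a.2.2.2.2.2.2 h3a⟩
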